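/- **Theorem 1.3 (Generalized Nayar's theorem).** Let $G$ be a finitely generated abelian group, written as an internal direct sum $G=G_1\oplus G_2$ with $G_1\cong\mathbb Z^m$ and $G_2\cong\bigoplus_{i=1}^l\mathbb Z_{q_i}$, where each $q_i$ is a power of a prime, and let $\pi_{G_1}:G\to G_1$, $x_1+x_2\mapsto x_1$ (for $x_i\in G_i$), be the projection. Let $S$ be a finite symmetric generating multiset of $G$ (that is, $S=-S$ with multiplicities; repeated elements and $0\in S$ are allowed), and let $\pi_{G_1}S$ be its image, with multiplicities, a generating multiset of $G_1$. For $u:G\to\mathbb R$ put $L^Su(x)=\sum_{s\in S}(u(x+s)-u(x))$ (sum with multiplicity), and let $d^S$ be the word metric, $d^S(x,y)$ being the least length of a path $x=x_0,x_1,\dots,x_k=y$ with $x_{j+1}-x_j\in S$. For real $d\ge 0$ and a base point $p\in G$ put $$H^d(G,S)=\{u:G\to\mathbb R \mid L^Su=0,\ \exists C\ \forall x:\ |u(x)|\le C(d^S(p,x)+1)^d\},$$ $$HM^d(G,S)=\operatorname{Span}_{\mathbb R}\{u:G\to\mathbb R \mid L^Su=0,\ \exists C\ \forall x:\ u(x)\ge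 -C(d^S(p,x)+1)^d\},$$ and define $H^d(G_1,\pi_{G_1}S)$ in the same way, with a base point $p_1\in G_1$. Then, for every real $d\ge 0$ and all base points $p\in G$, $p_1\in G_1$, $$HM^d(G,S)=H^d(G,S)=H^d(G_1,\pi_{G_1}S),$$ where a function $g$ on $G_1$ is identified with the function $g\circ\pi_{G_1}$ on $G$; that is, $H^d(G,S)=\{g\circ\pi_{G_1}\mid g\in H^d(G_1,\pi_{G_1}S)\}$. -/

import Mathlib

/-! Harmonic functions on Cayley graphs of abelian groups. The generating family `S` is a multiset:
repeated elements produce multiple edges and `0 ∈ S` produces self-loops. -/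

namespace AbelianCayley

/-- `S` is a symmetric (finite) generating multiset of the abelian group `G`: `S = -S` with
multiplicities, and `S` generates `G`. -/
structure IsSymmGen {G : Type*} [AddCommGroup G] (S : Multiset G) : Prop where
  symm : S.map (fun s => -s) = S
  gen : AddSubgroup.closure {s : G | s ∈ S} = ⊤

/-- Adjacency in the Cayley graph: `x ∼ y` iff `y - x ∈ S`. -/
def Adj {G : Type*} [AddCommGroup G] (S : Multiset G) (x y : G) : Prop :=
  y - x ∈ S

/-- The word metric: the least `k` such that there is a path `x = c 0 ∼ c 1 ∼ ⋯ ∼ c k = y`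
(such a path exists when `S` is a symmetric generating multiset). -/
noncomputable def wordDist {G : Type*} [AddCommGroup G] (S : Multiset G) (x y : G) : ℕ :=
  sInf {k : ℕ | ∃ c : ℕ → G, c 0 = x ∧ c k = y ∧ ∀ i < k, Adj S (c i) (c (i + 1))}

/-- The discrete Laplacian `L^S u (x) = ∑_{y ∼ x} (u y - u x)`, edges counted with multiplicity,
i.e. the sum over `s ∈ S` with multiplicity of `u (x + s) - u x`. -/
def laplacian {G : Type*} [AddCommGroup G] (S : Multiset G) (u : G → ℝ) (x : G) : ℝ :=
  (S.map (fun s => u (x + s) - u x)).sum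

/-- `u` is discrete harmonic on the Cayley graph `(G, S)`. -/
def IsHarmonic {G : Type*} [AddCommGroup G] (S : Multiset G) (u : G → ℝ) : Prop :=
  ∀ x, laplacian S u x = 0

/-- The space `H^d(G, S)` of harmonic functions with `|u x| ≤ C (d^S(p, x) + 1) ^ d` for some `C`,
where `p` is the base point. -/
def H {G : Type*} [AddCommGroup G] (S : Multiset G) (p : G) (d : ℝ) : Submodule ℝ (G → ℝ) where
  carrier := {u | IsHarmonic S u ∧
    ∃ C : ℝ, ∀ x, |u x| ≤ C * ((wordDist S p x : ℝ) + 1) ^ d}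
  zero_mem' := ⟨fun x => by simp [laplacian], 0, fun x => by simp⟩
  add_mem' := by
    rintro u v ⟨hu, C, hC⟩ ⟨hv, D, hD⟩
    refine ⟨fun x => ?_, C + D, fun x => ?_⟩
    · have h : laplacian S (u + v) x = laplacian S u x + laplacian S v x := by
        simp only [laplacian, ← Multiset.sum_map_add, Pi.add_apply]
        congr 2
        funext s
        ring
      rw [h, hu x, hv x, add_zero]
    · have h := abs_add_le (u x) (v x)
      have h1 := hC x
      have h2 := hD x
      rw [Pi.add_apply, add_mul]
      linarith
  smul_mem' := by
    rintro c u ⟨hu, C, hC⟩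
    refine ⟨fun x => ?_, |c| * C, fun x => ?_⟩
    · have h : laplacian S (c • u) x = c * laplacian S u x := by
        simp only [laplacian, ← Multiset.sum_map_mul_left, Pi.smul_apply, smul_eq_mul, mul_sub]
      rw [h, hu x, mul_zero]
    · rw [Pi.smul_apply, smul_eq_mul, abs_mul, mul_assoc]
      exact mul_le_mul_of_nonneg_left (hC x) (abs_nonneg c)

/-- The space `HM^d(G, S)`: the linear span of the harmonic functions that satisfy only the
one-sided bound `u x ≥ -C (d^S(p, x) + 1) ^ d` for some `C`. -/
def HM {G : Type*} [AddCommGroup G] (S : Multiset G) (p : G) (d : ℝ) : Submodule ℝ (G → ℝ) :=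
  Submodule.span ℝ {u | IsHarmonic S u ∧
    ∃ C : ℝ, ∀ x, -C * ((wordDist S p x : ℝ) + 1) ^ d ≤ u x}

/-- The projection `π_{G₁} : G → G₁` of an internal direct sum `G = G₁ ⊕ G₂`,
`x₁ + x₂ ↦ x₁`. -/
noncomputable def proj {G : Type*} [AddCommGroup G] {G₁ G₂ : Submodule ℤ G}
    (h : IsCompl G₁ G₂) : G →ₗ[ℤ] G₁ :=
  G₁.projectionOnto G₂ h

end AbelianCayley

/-! Everything is pulled back to a lattice. List `S` as `s : Fin n → G`, with multiplicity, and lift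
`u` to `z ↦ u (q + ∑ z i • s i)` on `ℤ^n`. Since `S = -S`, the lift of a harmonic function is
harmonic for the nearest-neighbour Laplacian (`lap_lift`). The word metric corresponds to the
lattice norm up to constants (`wordDist_bound_iff`), so growth conditions transfer both ways.

On the lattice two elementary estimates, both proved by barriers and the minimum principle, carry
the analysis: a gradient bound of order `sup |u| / R` (`abs_sub_le_of_harmonic`) and a weak Harnack
inequality (`weak_harnack`). Harnack first turns a one-sided bound into some polynomial bound. With
the gradient bound it then gives `|u| ≤ C₁ R^d + θ sup |u|`, the supremum being over a larger ball
and `θ` arbitrarily small; iteration removes the supremum and leaves order `d`. This is `HM = H`.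

By the gradient bound each difference lowers the order of growth by one, so iterated differences of
a function in `H` eventually vanish. Along a torsion element such a function is a polynomial on a
finite cycle, hence constant. Functions in `H` are therefore invariant under `G₂` and descend to
`G₁`; the growth conditions agree because the generators `s i` and `π (s i)` are lifted to the same
lattice. -/

/-! ### Nearest-neighbour harmonic functions on `ℤ^ι` -/

namespace LatticeHarmonic

variable {ι : Type*}

/-! ### Reflections and the gradient estimate. -/

section reflect

variable [DecidableEq ι]

/-- The lattice reflection that exchanges `0` and the unit vector `e_i`. -/
def reflect (i : ι) (z : ι → ℤ) : ι → ℤ := Function.update z i (1 - z i)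

lemma reflect_add_single (i : ι) (z : ι → ℤ) :
    reflect i (z + Pi.single i 1) = reflect i z - Pi.single i 1 := by
  ext j
  by_cases h : j = i
  · subst h; simp [reflect]
  · simp [reflect, h]

lemma reflect_sub_single (i : ι) (z : ι → ℤ) :
    reflect i (z - Pi.single i 1) = reflect i z + Pi.single i 1 := by
  ext j
  by_cases h : j = i
  · subst h; simp [reflect]; ring
  · simp [reflect, h]

lemma reflect_add_single_of_ne {i j : ι} (h : j ≠ i) (z : ι → ℤ) :
    reflect i (z + Pi.single j 1) = reflect i z + Pi.single j 1 := by
  ext k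
  by_cases hk : k = i
  · subst hk; simp [reflect, h.symm]
  · simp [reflect, hk]

lemma reflect_sub_single_of_ne {i j : ι} (h : j ≠ i) (z : ι → ℤ) :
    reflect i (z - Pi.single j 1) = reflect i z - Pi.single j 1 := by
  ext k
  by_cases hk : k = i
  · subst hk; simp [reflect, h.symm]
  · simp [reflect, hk]

lemma reflect_sub_single_of_apply_eq_one {i : ι} {z : ι → ℤ} (h : z i = 1) :
    reflect i (z - Pi.single i 1) = z := by
  ext j
  by_cases hj : j = i
  · subst hj; simp [reflect, h]
  · simp [reflect, hj]

lemma reflect_of_apply_eq_one {i : ι} {z : ι → ℤ} (h : z i = 1) :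
    reflect i z = z - Pi.single i 1 := by
  ext j
  by_cases hj : j = i
  · subst hj; simp [reflect, h]
  · simp [reflect, hj]

end reflect

variable [Fintype ι]

/-- The squared Euclidean length of a lattice vector. -/
def sqLen (z : ι → ℤ) : ℝ := ∑ i, (z i : ℝ) ^ 2

lemma sqLen_nonneg (z : ι → ℤ) : 0 ≤ sqLen z :=
  Finset.sum_nonneg fun _ _ => sq_nonneg _

lemma sq_le_sqLen (z : ι → ℤ) (i : ι) : (z i : ℝ) ^ 2 ≤ sqLen z :=
  Finset.single_le_sum (f := fun i => (z i : ℝ) ^ 2) (fun _ _ => sq_nonneg _) (Finset.mem_univ i)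

lemma norm_sq_le_sqLen (z : ι → ℤ) : ‖z‖ ^ 2 ≤ sqLen z := by
  have h : ‖z‖ ≤ √(sqLen z) := by
    refine (pi_norm_le_iff_of_nonneg (Real.sqrt_nonneg _)).2 fun i => ?_
    rw [Int.norm_eq_abs, ← Real.sqrt_sq_eq_abs]
    exact Real.sqrt_le_sqrt (sq_le_sqLen z i)
  calc ‖z‖ ^ 2 ≤ √(sqLen z) ^ 2 := by gcongr
    _ = sqLen z := Real.sq_sqrt (sqLen_nonneg z)

lemma sqLen_le_norm_sq (z : ι → ℤ) : sqLen z ≤ Fintype.card ι * ‖z‖ ^ 2 := by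
  have h : ∀ i ∈ Finset.univ, (z i : ℝ) ^ 2 ≤ ‖z‖ ^ 2 := fun i _ => by
    rw [← sq_abs, ← Int.norm_eq_abs]
    have := norm_le_pi_norm z i
    gcongr
  have h2 := Finset.sum_le_sum h
  rw [Finset.sum_const, Finset.card_univ, nsmul_eq_mul] at h2
  exact h2

lemma abs_apply_le_norm (z : ι → ℤ) (i : ι) : |(z i : ℝ)| ≤ ‖z‖ := by
  rw [← Int.norm_eq_abs]; exact norm_le_pi_norm z i

lemma finite_norm_le (R : ℝ) : {z : ι → ℤ | ‖z‖ ≤ R}.Finite := by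
  classical
  refine (Set.finite_Icc (fun _ : ι => -⌈R⌉) (fun _ => ⌈R⌉)).subset fun z hz => ?_
  have h : ∀ i, |z i| ≤ ⌈R⌉ := fun i => by
    have h1 := (abs_apply_le_norm z i).trans (hz.trans (Int.le_ceil R))
    exact_mod_cast h1
  exact ⟨fun i => (abs_le.1 (h i)).1, fun i => (abs_le.1 (h i)).2⟩

/-- The barrier for the gradient estimate in the half-box `{1 ≤ z i ≤ R, |z j| ≤ R}`. -/
def gradBarrier (i : ι) (R : ℝ) (z : ι → ℤ) : ℝ :=
  sqLen z - (z i : ℝ) ^ 2 - Fintype.card ι * (z i * (z i - 1))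
    + (Fintype.card ι + 1) * R * (2 * z i - 1)

/-- This makes the barrier at least `R ^ 2` as soon as one coordinate leaves the box: coordinate `i`
through the term `R * z i`, any other through its square. -/
lemma gradBarrier_ge {i : ι} {R : ℝ} (hR : 0 ≤ R) {z : ι → ℤ} (h1 : 1 ≤ z i)
    (h2 : (z i : ℝ) ≤ R + 1) : sqLen z - (z i : ℝ) ^ 2 + R * z i ≤ gradBarrier i R z := by
  have h1' : (1 : ℝ) ≤ z i := by exact_mod_cast h1
  have hN : (0 : ℝ) ≤ Fintype.card ι := by positivity
  have h3 : (Fintype.card ι : ℝ) * (z i * (z i - 1)) ≤ Fintype.card ι * (z i * R) := by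
    gcongr
    linarith
  have h4 : ((Fintype.card ι : ℝ) + 1) * R * z i
      ≤ (Fintype.card ι + 1) * R * (2 * z i - 1) := by
    gcongr
    linarith
  rw [gradBarrier]
  linarith

variable [DecidableEq ι]

/-- The nearest-neighbour Laplacian on `ℤ^ι`. -/
def lap (u : (ι → ℤ) → ℝ) (z : ι → ℤ) : ℝ :=
  ∑ i, (u (z + Pi.single i 1) + u (z - Pi.single i 1) - 2 * u z)

lemma sqLen_add_single (z : ι → ℤ) (i : ι) :
    sqLen (z + Pi.single i 1) = sqLen z + 2 * z i + 1 := by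
  have h : ∀ j, (((z + Pi.single i 1 : ι → ℤ) j : ℤ) : ℝ) ^ 2
      = (z j : ℝ) ^ 2 + if j = i then 2 * (z i : ℝ) + 1 else 0 := by
    intro j
    by_cases hj : j = i
    · subst hj; simp; ring
    · simp [hj]
  simp only [sqLen, h, Finset.sum_add_distrib, Finset.sum_ite_eq', Finset.mem_univ, if_true]
  ring

lemma sqLen_sub_single (z : ι → ℤ) (i : ι) :
    sqLen (z - Pi.single i 1) = sqLen z - 2 * z i + 1 := by
  have h := sqLen_add_single (z - Pi.single i 1) i
  simp only [sub_add_cancel, Pi.sub_apply, Pi.single_eq_same] at h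
  push_cast at h
  linarith

lemma norm_single_one (i : ι) : ‖(Pi.single i 1 : ι → ℤ)‖ = 1 := by
  rw [Pi.norm_single]; simp

lemma lap_sub (u v : (ι → ℤ) → ℝ) (z : ι → ℤ) :
    lap (fun x => u x - v x) z = lap u z - lap v z := by
  simp only [lap, ← Finset.sum_sub_distrib]
  exact Finset.sum_congr rfl fun _ _ => by ring

lemma lap_const_mul (c : ℝ) (u : (ι → ℤ) → ℝ) (z : ι → ℤ) :
    lap (fun x => c * u x) z = c * lap u z := by
  simp only [lap, Finset.mul_sum]
  exact Finset.sum_congr rfl fun _ _ => by ring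

lemma lap_neg (u : (ι → ℤ) → ℝ) (z : ι → ℤ) : lap (fun x => -u x) z = -lap u z := by
  simpa using lap_const_mul (-1) u z

lemma lap_add_const (u : (ι → ℤ) → ℝ) (c : ℝ) (z : ι → ℤ) :
    lap (fun x => u x + c) z = lap u z := by
  simp only [lap]
  exact Finset.sum_congr rfl fun _ _ => by ring

lemma lap_translate (u : (ι → ℤ) → ℝ) (v z : ι → ℤ) :
    lap (fun x => u (x + v)) z = lap u (z + v) := by
  simp only [lap]
  refine Finset.sum_congr rfl fun i _ => ?_
  rw [add_right_comm, sub_add_eq_add_sub]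

/-- Where the Laplacian is negative, some neighbour has a smaller value. -/
lemma exists_neighbour_lt {f : (ι → ℤ) → ℝ} {z : ι → ℤ} (h : lap f z < 0) :
    ∃ i, f (z + Pi.single i 1) < f z ∨ f (z - Pi.single i 1) < f z := by
  by_contra! hc
  refine h.not_ge (Finset.sum_nonneg fun i _ => ?_)
  linarith [(hc i).1, (hc i).2]

/-- A form of the maximum principle: a function on a finite set that has no minimum at a point
where it is negative is nonnegative. -/
lemma nonneg_of_forall_exists_lt {α : Type*} {Ω : Set α} (hΩ : Ω.Finite) {f : α → ℝ}
    (h : ∀ x ∈ Ω, f x < 0 → ∃ y ∈ Ω, f y < f x) {x : α} (hx : x ∈ Ω) : 0 ≤ f x := by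
  obtain ⟨y, hy, hmin⟩ := Set.exists_min_image Ω f hΩ ⟨x, hx⟩
  by_contra! hneg
  obtain ⟨w, hw, hwy⟩ := h y hy ((hmin x hx).trans_lt hneg)
  exact (hmin w hw).not_gt hwy

lemma lap_reflect (u : (ι → ℤ) → ℝ) (i : ι) (z : ι → ℤ) :
    lap (fun x => u (reflect i x)) z = lap u (reflect i z) := by
  refine Finset.sum_congr rfl fun j _ => ?_
  beta_reduce
  by_cases h : j = i
  · subst h; rw [reflect_add_single, reflect_sub_single]; ring
  · rw [reflect_add_single_of_ne h, reflect_sub_single_of_ne h]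

/-- The squares of the other coordinates contribute `2 (N - 1)`, where `N = Fintype.card ι`, the
concave term in `z i` contributes `-2 N`, and the linear term nothing. -/
lemma lap_gradBarrier (i : ι) (R : ℝ) (z : ι → ℤ) : lap (gradBarrier i R) z = -2 := by
  have h : ∀ j, gradBarrier i R (z + Pi.single j 1) + gradBarrier i R (z - Pi.single j 1)
      - 2 * gradBarrier i R z
      = 2 - if j = i then 2 + 2 * (Fintype.card ι : ℝ) else 0 := by
    intro j
    simp only [gradBarrier, sqLen_add_single, sqLen_sub_single]
    by_cases hj : j = i
    · subst hj; simp; ring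
    · simp [hj, Ne.symm hj]; ring
  simp only [lap, h, Finset.sum_sub_distrib, Finset.sum_ite_eq', Finset.mem_univ, if_true,
    Finset.sum_const, Finset.card_univ, nsmul_eq_mul]
  ring

lemma sq_le_sqLen_sub {i j : ι} (h : j ≠ i) (z : ι → ℤ) :
    (z j : ℝ) ^ 2 ≤ sqLen z - (z i : ℝ) ^ 2 := by
  rw [sqLen, ← Finset.sum_erase_eq_sub (Finset.mem_univ i)]
  exact Finset.single_le_sum (f := fun i => (z i : ℝ) ^ 2) (fun _ _ => sq_nonneg _)
    (Finset.mem_erase.2 ⟨h, Finset.mem_univ j⟩)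

/-- The one-sided gradient estimate at the origin. -/
lemma sub_le_of_harmonic_box {u : (ι → ℤ) → ℝ} (hu : ∀ z, lap u z = 0) {R : ℕ} (hR : 1 ≤ R)
    {K : ℝ} (hK : 0 < K) (hb : ∀ z : ι → ℤ, (∀ j, |z j| ≤ R + 1) → |u z| ≤ K) (i : ι) :
    u (Pi.single i 1) - u 0 ≤ 2 * K * (Fintype.card ι + 1) / R := by
  have hR' : (1 : ℝ) ≤ R := by exact_mod_cast hR
  -- `w` is harmonic and odd under the mirror `z i = 1/2`, and `w (e_i)` is the difference to be
  -- estimated. It is compared with a multiple of the barrier, which equals `(N + 1) R` at `e_i`.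
  set w : (ι → ℤ) → ℝ := fun z => u z - u (reflect i z) with hw
  set f : (ι → ℤ) → ℝ := fun z => 2 * K / R ^ 2 * gradBarrier i R z - w z with hf
  have hwlap : ∀ z, lap w z = 0 := fun z => by
    rw [hw, lap_sub u (fun z => u (reflect i z)), lap_reflect, hu, hu, sub_zero]
  have hflap : ∀ z, lap f z < 0 := fun z => by
    rw [hf, lap_sub (fun z => 2 * K / R ^ 2 * gradBarrier i R z), lap_const_mul,
      lap_gradBarrier, hwlap]
    have : 0 < 2 * K / (R : ℝ) ^ 2 := by positivity
    linarith
  set Ω : Set (ι → ℤ) := {z | (∀ j, |z j| ≤ R) ∧ 1 ≤ z i} with hΩ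
  have hfin : Ω.Finite := by
    refine (Set.finite_Icc (fun _ : ι => -(R : ℤ)) (fun _ => (R : ℤ))).subset fun z hz => ?_
    exact ⟨fun i => (abs_le.1 (hz.1 i)).1, fun i => (abs_le.1 (hz.1 i)).2⟩
  -- outside of `Ω` but on the same side of the mirror, `f` is nonnegative
  have hout : ∀ z : ι → ℤ, (∀ j, |z j| ≤ R + 1) → 1 ≤ z i → z ∉ Ω → 0 ≤ f z := by
    intro z hz hzi hzΩ
    have hwz : w z ≤ 2 * K := by
      have h1 := hb z hz
      have h2 := hb (reflect i z) fun j => by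
        by_cases hj : j = i
        · subst hj
          have := (abs_le.1 (hz j)).2
          simp only [reflect, Function.update_self]
          exact abs_le.2 ⟨by linarith, by linarith⟩
        · simpa [reflect, hj] using hz j
      have := (abs_le.1 h1).2
      have := (abs_le.1 h2).1
      simp only [hw]; linarith
    have hge : (R : ℝ) ^ 2 ≤ gradBarrier i R z := by
      have hzR : (z i : ℝ) ≤ R + 1 := by exact_mod_cast (abs_le.1 (hz i)).2
      have hzi' : (1 : ℝ) ≤ z i := by exact_mod_cast hzi
      have hg := gradBarrier_ge (by linarith) hzi hzR
      obtain ⟨j, hj⟩ : ∃ j, (R : ℤ) < |z j| := by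
        by_contra! hc
        exact hzΩ ⟨hc, hzi⟩
      have hj' : (R : ℝ) ≤ |(z j : ℝ)| := by exact_mod_cast hj.le
      by_cases hji : j = i
      · subst hji
        rw [abs_of_pos (by linarith)] at hj'
        have := sq_le_sqLen z j
        nlinarith
      · have h1 := sq_le_sqLen_sub hji z
        have h2 : (R : ℝ) ^ 2 ≤ (z j : ℝ) ^ 2 := by
          rw [← sq_abs (z j : ℝ)]; gcongr
        have h3 : 0 ≤ (R : ℝ) * z i := by positivity
        linarith
    have h4 : 2 * K / (R : ℝ) ^ 2 * R ^ 2 ≤ 2 * K / R ^ 2 * gradBarrier i R z := by gcongr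
    rw [div_mul_cancel₀ _ (by positivity)] at h4
    simp only [hf]; linarith
  have hmem : (Pi.single i 1 : ι → ℤ) ∈ Ω := by
    refine ⟨fun j => ?_, by simp⟩
    by_cases hj : j = i
    · subst hj; simpa using hR
    · simp [hj]
  have key := nonneg_of_forall_exists_lt hfin (f := f) (fun z hz hneg => ?_) hmem
  · have h0 : reflect i (Pi.single i 1) = 0 := by
      rw [reflect_of_apply_eq_one (by simp), sub_self]
    have h1 : gradBarrier i R (Pi.single i 1) = (Fintype.card ι + 1) * R := by
      have := sqLen_add_single (0 : ι → ℤ) i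
      rw [zero_add] at this
      simp only [gradBarrier, this]
      simp [sqLen]; ring
    simp only [hf, hw, h0, h1] at key
    have h2 : 2 * K / (R : ℝ) ^ 2 * ((Fintype.card ι + 1) * R)
        = 2 * K * (Fintype.card ι + 1) / R := by field_simp
    linarith
  · have hz1 : ∀ j k, |(z + Pi.single k 1 : ι → ℤ) j| ≤ R + 1 ∧
        |(z - Pi.single k 1 : ι → ℤ) j| ≤ R + 1 := fun j k => by
      have := abs_le.1 (hz.1 j)
      by_cases hj : j = k
      · subst hj
        simp only [Pi.add_apply, Pi.sub_apply, Pi.single_eq_same, abs_le]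
        omega
      · simp only [Pi.add_apply, Pi.sub_apply, Pi.single_eq_of_ne hj, abs_le]
        omega
    have hstep : ∀ y : ι → ℤ, (∀ j, |y j| ≤ R + 1) → 1 ≤ y i → f y < f z →
        ∃ y ∈ Ω, f y < f z := fun y hy hyi hlt => by
      by_cases hyΩ : y ∈ Ω
      · exact ⟨y, hyΩ, hlt⟩
      · linarith [hout y hy hyi hyΩ]
    obtain ⟨k, hk | hk⟩ := exists_neighbour_lt (hflap z)
    · refine hstep _ (fun j => (hz1 j k).1) ?_ hk
      have := hz.2
      by_cases hki : i = k
      · subst hki; simp; omega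
      · simpa [hki] using this
    · by_cases hki : i = k
      · subst hki
        by_cases hzi : z i = 1
        -- The smaller neighbour lies across the mirror. There `w` changes sign, and in the sum of
        -- the two barrier values the odd term cancels, so the two values of `f` have nonnegative
        -- sum and cannot both be negative.
        · have h1 : w (z - Pi.single i 1) = -w z := by
            simp only [hw, reflect_sub_single_of_apply_eq_one hzi, reflect_of_apply_eq_one hzi]
            ring
          have h2 : 0 ≤ gradBarrier i R (z - Pi.single i 1) + gradBarrier i R z := by
            have := sq_le_sqLen z i
            simp only [gradBarrier, sqLen_sub_single, Pi.sub_apply, Pi.single_eq_same, hzi] at this ⊢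
            push_cast at this ⊢
            linarith
          have h3 : 0 ≤ 2 * K / (R : ℝ) ^ 2 *
              (gradBarrier i R (z - Pi.single i 1) + gradBarrier i R z) := by positivity
          simp only [hf] at hk hneg
          rw [h1] at hk
          linarith
        · refine hstep _ (fun j => (hz1 j i).2) ?_ hk
          have := hz.2
          simp only [Pi.sub_apply, Pi.single_eq_same]
          omega
      · refine hstep _ (fun j => (hz1 j k).2) ?_ hk
        simpa [hki] using hz.2

/-- The gradient estimate for harmonic functions on the lattice. -/
lemma abs_sub_le_of_harmonic {u : (ι → ℤ) → ℝ} (hu : ∀ z, lap u z = 0) {R : ℝ} (hR : 1 ≤ R)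
    {K : ℝ} (hK : 0 ≤ K) {x : ι → ℤ} (hb : ∀ z : ι → ℤ, ‖z - x‖ ≤ 2 * R → |u z| ≤ K) (i : ι) :
    |u (x + Pi.single i 1) - u x| ≤ 4 * K * (Fintype.card ι + 1) / R := by
  have h0 : 1 ≤ ⌊R⌋₊ := Nat.one_le_floor_iff _ |>.2 hR
  have hfl : (⌊R⌋₊ : ℝ) ≤ R := Nat.floor_le (by linarith)
  have hfl' : R ≤ 2 * ⌊R⌋₊ := by
    have h1 := (Nat.lt_floor_add_one R).le
    have h2 : (1 : ℝ) ≤ ⌊R⌋₊ := by exact_mod_cast h0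
    linarith
  have hN : (0 : ℝ) ≤ Fintype.card ι := by positivity
  have hb' : ∀ z : ι → ℤ, (∀ j, |z j| ≤ (⌊R⌋₊ : ℤ) + 1) → |u (z + x)| ≤ K := fun z hz => by
    refine hb _ ?_
    rw [add_sub_cancel_right]
    refine (pi_norm_le_iff_of_nonneg (by linarith)).2 fun j => ?_
    rw [Int.norm_eq_abs]
    have h1 : |(z j : ℝ)| ≤ ⌊R⌋₊ + 1 := by exact_mod_cast hz j
    linarith
  have hlim : ∀ v : (ι → ℤ) → ℝ, (∀ z, lap v z = 0) →
      (∀ z : ι → ℤ, (∀ j, |z j| ≤ (⌊R⌋₊ : ℤ) + 1) → |v z| ≤ K) →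
      v (Pi.single i 1) - v 0 ≤ 4 * K * (Fintype.card ι + 1) / R := by
    intro v hv hvb
    -- The box estimate needs a positive bound for a strictly superharmonic comparison, so `K + ε`
    -- is used and `ε → 0`. Passing from `⌊R⌋₊` to `R` costs the remaining factor 2.
    have h1 : ∀ ε > 0, v (Pi.single i 1) - v 0 ≤
        2 * (K + ε) * (Fintype.card ι + 1) / ⌊R⌋₊ := fun ε hε =>
      sub_le_of_harmonic_box hv h0 (by linarith) (fun z hz => (hvb z hz).trans (by linarith)) i
    have h2 : v (Pi.single i 1) - v 0 ≤ 2 * K * (Fintype.card ι + 1) / ⌊R⌋₊ := by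
      have hc : Filter.Tendsto (fun ε : ℝ => 2 * (K + ε) * (Fintype.card ι + 1) / ⌊R⌋₊)
          (nhdsWithin 0 (Set.Ioi 0)) (nhds (2 * (K + 0) * (Fintype.card ι + 1) / ⌊R⌋₊)) :=
        (Continuous.tendsto (by fun_prop) 0).mono_left nhdsWithin_le_nhds
      rw [add_zero] at hc
      exact ge_of_tendsto hc (Filter.eventually_of_mem self_mem_nhdsWithin h1)
    refine h2.trans ?_
    rw [div_le_div_iff₀ (by linarith) (by linarith)]
    nlinarith [mul_nonneg hK (by linarith : (0:ℝ) ≤ Fintype.card ι + 1)]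
  have h1 := hlim (fun z => u (z + x)) (fun z => by rw [lap_translate, hu]) hb'
  have h2 := hlim (fun z => -u (z + x))
    (fun z => by rw [lap_neg (fun z => u (z + x)), lap_translate, hu, neg_zero])
    (fun z hz => by rw [abs_neg]; exact hb' z hz)
  rw [zero_add, add_comm _ x] at h1 h2
  exact abs_le.2 ⟨by linarith, h1⟩

end LatticeHarmonic

/-! ### Radial barriers and the weak Harnack inequality. -/

namespace LatticeHarmonic

variable {ι : Type*}

/-- The cubic Taylor polynomial of `(1 + z)⁻ᴹ` is a lower bound. -/
lemma taylor_le_inv_pow (M : ℕ) {z : ℝ} (hz : -1 < z) :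
    1 - M * z + M * (M + 1) / 2 * z ^ 2 - M * (M + 1) * (M + 2) / 6 * z ^ 3
      ≤ ((1 + z) ^ M)⁻¹ := by
  have hz' : 0 < 1 + z := by linarith
  induction M with
  | zero => simp
  | succ M ih =>
    rw [pow_succ (1 + z), mul_inv, ← div_eq_mul_inv, le_div_iff₀ hz']
    refine le_trans ?_ ih
    push_cast
    -- Multiplying the cubic for `M + 1` by `1 + z` gives the cubic for `M` minus exactly this
    -- quartic term.
    have h : (0 : ℝ) ≤ (M + 1) * (M + 2) * (M + 3) / 6 * z ^ 4 := by positivity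
    linarith

lemma two_add_le_inv_pow_add_inv_pow (M : ℕ) {z : ℝ} (hz : |z| < 1) :
    2 + M * (M + 1) * z ^ 2 ≤ ((1 + z) ^ M)⁻¹ + ((1 - z) ^ M)⁻¹ := by
  have h1 := taylor_le_inv_pow M (abs_lt.1 hz).1
  have h2 := taylor_le_inv_pow M (z := -z) (by linarith [(abs_lt.1 hz).2])
  rw [← sub_eq_add_neg] at h2
  linarith

variable [Fintype ι]

/-- The function `(‖x‖² + a)⁻ᴹ`, a barrier for lower bounds of harmonic functions. -/
noncomputable def radial (M : ℕ) (a : ℝ) (x : ι → ℤ) : ℝ := ((sqLen x + a) ^ M)⁻¹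

lemma radial_anti (M : ℕ) {a b : ℝ} {x : ι → ℤ} (hb : 0 < b) (h : b ≤ sqLen x + a) :
    radial M a x ≤ (b ^ M)⁻¹ := by
  rw [radial]; gcongr

variable [DecidableEq ι]

lemma radial_neighbours_ge (M : ℕ) {a : ℝ} (ha : 0 < a) (x : ι → ℤ) (i : ι) :
    ((sqLen x + a + 1) ^ M)⁻¹ * (2 + M * (M + 1) * (4 * (x i : ℝ) ^ 2 / (sqLen x + a + 1) ^ 2))
      ≤ radial M a (x + Pi.single i 1) + radial M a (x - Pi.single i 1) := by
  have hq := sq_le_sqLen x i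
  set T := sqLen x + a + 1 with hT
  have hT0 : 0 < T := by nlinarith [sq_nonneg (x i : ℝ)]
  have hz : |2 * (x i : ℝ) / T| < 1 := by
    rw [abs_div, abs_of_pos hT0, div_lt_one hT0, abs_lt]
    constructor <;> nlinarith [sq_nonneg ((x i : ℝ) - 1), sq_nonneg ((x i : ℝ) + 1)]
  have h1 : radial M a (x + Pi.single i 1) = (T ^ M)⁻¹ * ((1 + 2 * x i / T) ^ M)⁻¹ := by
    rw [radial, sqLen_add_single, ← mul_inv, ← mul_pow, mul_add, mul_div_cancel₀ _ hT0.ne', hT]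
    ring_nf
  have h2 : radial M a (x - Pi.single i 1) = (T ^ M)⁻¹ * ((1 - 2 * x i / T) ^ M)⁻¹ := by
    rw [radial, sqLen_sub_single, ← mul_inv, ← mul_pow, mul_sub, mul_div_cancel₀ _ hT0.ne', hT]
    ring_nf
  rw [h1, h2, ← mul_add]
  refine mul_le_mul_of_nonneg_left ?_ (by positivity)
  have h3 := two_add_le_inv_pow_add_inv_pow M hz
  rw [div_pow, mul_pow] at h3
  norm_num at h3
  linarith

/-- The power `3N` is large enough for the second-order gain `12N(3N+1)|x|²/(r+1)²`, with `r = |x|²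
+ a ≤ 2|x|²`, to exceed the loss `12N²/(r+1)` from replacing `r` by `r + 1` in the central value. -/
lemma lap_radial_pos [Nonempty ι] {a : ℝ} (ha : 6 * Fintype.card ι ≤ a) {x : ι → ℤ}
    (hx : a ≤ sqLen x) : 0 < lap (radial (3 * Fintype.card ι) a) x := by
  set N := Fintype.card ι with hN
  have hN1 : (1 : ℝ) ≤ N := by exact_mod_cast Fintype.card_pos (α := ι)
  have ha0 : 0 < a := by linarith
  set r := sqLen x + a with hr
  have hr0 : 0 < r := by linarith
  have hsum : ((r + 1) ^ (3 * N))⁻¹ *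
      (2 * N + 3 * N * (3 * N + 1) * (4 * sqLen x / (r + 1) ^ 2)) - 2 * N * (r ^ (3 * N))⁻¹
      ≤ lap (radial (3 * N) a) x := by
    have h := Finset.sum_le_sum fun i (_ : i ∈ Finset.univ) => radial_neighbours_ge (3 * N) ha0 x i
    rw [← Finset.mul_sum, Finset.sum_add_distrib, ← Finset.mul_sum, ← Finset.sum_div,
      ← Finset.mul_sum, Finset.sum_const, Finset.card_univ, nsmul_eq_mul] at h
    simp only [lap, Finset.sum_sub_distrib, Finset.sum_const, Finset.card_univ, nsmul_eq_mul]
    push_cast at h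
    change _ * (_ + _ * (4 * sqLen x / _)) ≤ _ at h
    have h3 : radial (3 * N) a x = (r ^ (3 * N))⁻¹ := rfl
    rw [h3, ← hN]
    rw [← hN, ← hr] at h
    linarith
  refine lt_of_lt_of_le ?_ hsum
  have hpow : (r ^ (3 * N))⁻¹ ≤ ((r + 1) ^ (3 * N))⁻¹ * (1 + 2 * (3 * N) / (r + 1)) := by
    -- Bernoulli bounds the ratio of powers below by `1 - y`, and `(1 - y)(1 + 2y) ≥ 1` for `0 ≤ y ≤
    -- 1/2`.
    have hb := one_add_mul_le_pow (a := -(1 / (r + 1))) (by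
      have : 1 / (r + 1) ≤ 1 := by rw [div_le_one (by linarith)]; linarith
      linarith) (3 * N)
    have h1 : 1 + -(1 / (r + 1)) = r / (r + 1) := by field_simp; ring
    rw [h1, div_pow] at hb
    push_cast at hb
    set y := 3 * (N : ℝ) / (r + 1) with hy
    have hy0 : 0 ≤ y := by positivity
    have hy2 : y ≤ 1 / 2 := by
      rw [hy, div_le_div_iff₀ (by linarith) (by norm_num)]; linarith
    have hb' : 1 - y ≤ r ^ (3 * N) / (r + 1) ^ (3 * N) := by
      refine le_trans (le_of_eq ?_) hb
      rw [hy]; ring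
    have h2 : 1 ≤ r ^ (3 * N) / (r + 1) ^ (3 * N) * (1 + 2 * y) :=
      calc (1 : ℝ) ≤ (1 - y) * (1 + 2 * y) := by nlinarith
        _ ≤ _ := by gcongr
    have h3 : 2 * (3 * (N : ℝ)) / (r + 1) = 2 * y := by rw [hy]; ring
    rw [h3, inv_le_iff_one_le_mul₀ (by positivity)]
    refine h2.trans (le_of_eq ?_)
    rw [div_eq_mul_inv]; ring
  have hmain : 2 * N * (1 + 2 * (3 * N) / (r + 1))
      < 2 * N + 3 * N * (3 * N + 1) * (4 * sqLen x / (r + 1) ^ 2) := by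
    have h1 : 2 * N * (1 + 2 * (3 * N) / (r + 1)) = 2 * N + 12 * N * (N * (r + 1)) / (r + 1) ^ 2 := by
      field_simp; ring
    have h2 : 3 * N * (3 * N + 1) * (4 * sqLen x / (r + 1) ^ 2)
        = 12 * N * ((3 * N + 1) * sqLen x) / (r + 1) ^ 2 := by ring
    rw [h1, h2]
    have h3 : N * (r + 1) < (3 * N + 1) * sqLen x := by nlinarith
    have h4 : 0 < 12 * (N : ℝ) := by linarith
    have := div_lt_div_of_pos_right (mul_lt_mul_of_pos_left h3 h4)
      (show 0 < (r + 1) ^ 2 by positivity)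
    linarith
  have hinv : 0 < ((r + 1) ^ (3 * N))⁻¹ := by positivity
  nlinarith [mul_lt_mul_of_pos_left hmain hinv]

/-- Weak Harnack inequality: a nonnegative harmonic function that is at least `m` on a ball is
bounded below on larger balls, with polynomial loss. -/
lemma weak_harnack [Nonempty ι] {v : (ι → ℤ) → ℝ} (hv : ∀ z, lap v z = 0) {a Q m : ℝ}
    (ha : 6 * Fintype.card ι ≤ a) (haQ : a ≤ Q) (hm : 0 < m) {y x₀ : ι → ℤ}
    (h0 : ∀ x, sqLen (x - y) ≤ 16 * Q → 0 ≤ v x) (h1 : ∀ x, sqLen (x - y) ≤ a → m ≤ v x)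
    (hx₀ : sqLen (x₀ - y) ≤ Q) : m * (a / (4 * Q)) ^ (3 * Fintype.card ι) ≤ v x₀ := by
  set M := 3 * Fintype.card ι with hM
  have hN1 : 1 ≤ Fintype.card ι := Fintype.card_pos
  have hN1' : (1 : ℝ) ≤ Fintype.card ι := by exact_mod_cast hN1
  have ha0 : 0 < a := by linarith
  have hQ0 : 0 < Q := by linarith
  -- The subtracted barrier is at most `m` on the inner ball and nonpositive beyond `4 * Q`. A
  -- lattice step from the annulus stays within `16 * Q`, where `v` is known to be nonnegative.
  set f : (ι → ℤ) → ℝ := fun x => v x - m * a ^ M * (radial M a (x + -y) + -(((4 * Q) ^ M)⁻¹))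
    with hf
  have hflap : ∀ x, a ≤ sqLen (x - y) → lap f x < 0 := fun x hx => by
    rw [hf, lap_sub v (fun x => m * a ^ M * (radial M a (x + -y) + -(((4 * Q) ^ M)⁻¹))), hv,
      lap_const_mul (m * a ^ M) (fun x => radial M a (x + -y) + -(((4 * Q) ^ M)⁻¹)),
      lap_add_const (fun x => radial M a (x + -y)), lap_translate]
    rw [sub_eq_add_neg] at hx
    have := lap_radial_pos ha hx
    have : 0 < m * a ^ M * lap (radial M a) (x + -y) := by positivity
    linarith
  -- the function `f` is nonnegative off the annulus
  have hin : ∀ x, sqLen (x - y) ≤ a → 0 ≤ f x := fun x hx => by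
    have h2 := h1 x hx
    have h3 : radial M a (x + -y) ≤ (a ^ M)⁻¹ :=
      radial_anti M ha0 (by linarith [sqLen_nonneg (x + -y)])
    have h4 : 0 ≤ ((4 * Q) ^ M)⁻¹ := by positivity
    have h5 : m * a ^ M * (radial M a (x + -y) + -(((4 * Q) ^ M)⁻¹)) ≤ m * a ^ M * (a ^ M)⁻¹ := by
      gcongr; linarith
    rw [mul_inv_cancel_right₀ (by positivity)] at h5
    simp only [hf]; linarith
  have hout : ∀ x, 4 * Q ≤ sqLen (x - y) → sqLen (x - y) ≤ 16 * Q → 0 ≤ f x := fun x hx hx' => by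
    have h2 := h0 x hx'
    rw [sub_eq_add_neg] at hx
    have h3 : radial M a (x + -y) ≤ ((4 * Q) ^ M)⁻¹ :=
      radial_anti M (by linarith) (by linarith)
    have h5 : m * a ^ M * (radial M a (x + -y) + -(((4 * Q) ^ M)⁻¹)) ≤ 0 :=
      mul_nonpos_of_nonneg_of_nonpos (by positivity) (by linarith)
    simp only [hf]; linarith
  set Ω : Set (ι → ℤ) := {x | a ≤ sqLen (x - y) ∧ sqLen (x - y) ≤ 4 * Q} with hΩ
  have hfin : Ω.Finite := by
    refine ((finite_norm_le (√(4 * Q))).image (· + y)).subset fun x hx => ⟨x - y, ?_, by simp⟩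
    exact Real.le_sqrt_of_sq_le ((norm_sq_le_sqLen _).trans hx.2)
  have hfx₀ : 0 ≤ f x₀ := by
    rcases le_total a (sqLen (x₀ - y)) with hax | hax
    · refine nonneg_of_forall_exists_lt hfin (fun x hx hneg => ?_)
        (show x₀ ∈ Ω from ⟨hax, by linarith⟩)
      have hstep : ∀ w : ι → ℤ, sqLen (w - y) ≤ 16 * Q → f w < f x → ∃ w ∈ Ω, f w < f x := by
        intro w hw hlt
        refine ⟨w, ⟨?_, ?_⟩, hlt⟩
        · by_contra! hc
          linarith [hin w hc.le]
        · by_contra! hc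
          linarith [hout w hc.le hw]
      have hcoord : ∀ i, |((x - y) i : ℝ)| * 2 ≤ sqLen (x - y) + 1 := fun i => by
        have := sq_le_sqLen (x - y) i
        rw [← sq_abs] at this
        nlinarith [sq_nonneg (|(((x - y) i : ℤ) : ℝ)| - 1)]
      obtain ⟨k, hk | hk⟩ := exists_neighbour_lt (hflap x hx.1)
      · refine hstep _ ?_ hk
        rw [add_sub_right_comm, sqLen_add_single]
        linarith [hcoord k, le_abs_self (((x - y) k : ℤ) : ℝ), hx.2]
      · refine hstep _ ?_ hk
        rw [sub_right_comm, sqLen_sub_single]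
        linarith [hcoord k, neg_abs_le (((x - y) k : ℤ) : ℝ), hx.2]
    · exact hin x₀ hax
  have hlow : ((2 * Q) ^ M)⁻¹ ≤ radial M a (x₀ + -y) := by
    rw [radial, ← sub_eq_add_neg]
    have := sqLen_nonneg (x₀ - y)
    gcongr
    linarith
  have htwo : 2 * ((4 * Q) ^ M)⁻¹ ≤ ((2 * Q) ^ M)⁻¹ := by
    have h2 : (4 * Q) ^ M = 2 ^ M * (2 * Q) ^ M := by rw [← mul_pow]; ring
    have h3 : (2 : ℝ) ≤ 2 ^ M := by
      calc (2 : ℝ) = 2 ^ 1 := by norm_num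
        _ ≤ 2 ^ M := pow_le_pow_right₀ (by norm_num) (by omega)
    rw [h2, mul_inv, ← mul_assoc]
    refine mul_le_of_le_one_left (by positivity) ?_
    rw [← div_eq_mul_inv, div_le_one (by positivity)]
    exact h3
  have h6 : m * a ^ M * ((4 * Q) ^ M)⁻¹
      ≤ m * a ^ M * (radial M a (x₀ + -y) + -(((4 * Q) ^ M)⁻¹)) := by
    gcongr; linarith
  have h7 : m * (a / (4 * Q)) ^ M = m * a ^ M * ((4 * Q) ^ M)⁻¹ := by
    rw [div_pow, div_eq_mul_inv]; ring
  simp only [hf] at hfx₀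
  rw [h7]; linarith

end LatticeHarmonic

/-! ### Gradient and Harnack bounds along lattice paths. -/

namespace LatticeHarmonic

variable {ι : Type*} [Fintype ι]

/-- The `ℓ¹` length of a lattice vector. -/
def l1 (v : ι → ℤ) : ℕ := ∑ i, (v i).natAbs

lemma l1_le_norm (v : ι → ℤ) : (l1 v : ℝ) ≤ Fintype.card ι * ‖v‖ := by
  have h : ∀ i ∈ Finset.univ, ((v i).natAbs : ℝ) ≤ ‖v‖ := fun i _ => by
    rw [Nat.cast_natAbs, Int.cast_abs]; exact abs_apply_le_norm v i
  have h2 := Finset.sum_le_sum h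
  rw [Finset.sum_const, Finset.card_univ, nsmul_eq_mul] at h2
  rw [l1, Nat.cast_sum]; exact h2

lemma norm_le_l1 (v : ι → ℤ) : ‖v‖ ≤ l1 v := by
  refine (pi_norm_le_iff_of_nonneg (by positivity)).2 fun i => ?_
  rw [Int.norm_eq_abs, ← Int.cast_abs, ← Nat.cast_natAbs]
  exact_mod_cast Finset.single_le_sum (f := fun i => (v i).natAbs) (fun _ _ => Nat.zero_le _)
    (Finset.mem_univ i)

lemma eq_zero_of_l1_eq_zero {v : ι → ℤ} (h : l1 v = 0) : v = 0 := by
  ext i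
  have := Finset.sum_eq_zero_iff.1 h i (Finset.mem_univ i)
  simpa using this

variable [DecidableEq ι]

lemma l1_eq_add_erase (v : ι → ℤ) (i : ι) :
    l1 v = (v i).natAbs + ∑ j ∈ Finset.univ.erase i, (v j).natAbs :=
  (Finset.add_sum_erase _ (fun j => (v j).natAbs) (Finset.mem_univ i)).symm

/-- A lattice vector of length `n + 1` is one step away from a vector of length `n`. -/
lemma exists_step {v : ι → ℤ} {n : ℕ} (h : l1 v = n + 1) :
    ∃ i w, l1 w = n ∧ (v = w + Pi.single i 1 ∨ v = w - Pi.single i 1) := by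
  obtain ⟨i, hi⟩ : ∃ i, v i ≠ 0 := by
    by_contra! hc
    simp [l1, hc] at h
  have herase : ∀ c : ℤ, ∑ j ∈ Finset.univ.erase i, ((v + Pi.single i c : ι → ℤ) j).natAbs
      = ∑ j ∈ Finset.univ.erase i, (v j).natAbs := fun c =>
    Finset.sum_congr rfl fun j hj => by simp [Finset.ne_of_mem_erase hj]
  rw [l1_eq_add_erase v i] at h
  rcases lt_or_gt_of_ne hi with hneg | hpos
  · refine ⟨i, v + Pi.single i 1, ?_, Or.inr (by simp)⟩
    rw [l1_eq_add_erase _ i, herase]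
    simp only [Pi.add_apply, Pi.single_eq_same]
    omega
  · refine ⟨i, v + Pi.single i (-1), ?_, Or.inl ?_⟩
    · rw [l1_eq_add_erase _ i, herase]
      simp only [Pi.add_apply, Pi.single_eq_same]
      omega
    · rw [add_assoc, ← Pi.single_add]; simp

/-- A gradient bound integrates along lattice paths. -/
lemma abs_sub_le_l1_mul {u : (ι → ℤ) → ℝ} {T G : ℝ}
    (h : ∀ w i, ‖w‖ ≤ T → |u (w + Pi.single i 1) - u w| ≤ G) (n : ℕ) :
    ∀ v z : ι → ℤ, l1 v = n → ‖z‖ + n ≤ T → |u (z + v) - u z| ≤ n * G := by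
  induction n with
  | zero => intro v z hv _; simp [eq_zero_of_l1_eq_zero hv]
  | succ n ih =>
    intro v z hv hT
    push_cast at hT ⊢
    obtain ⟨i, w, hw, hvw⟩ := exists_step hv
    have h1 := ih w z hw (by linarith)
    have hstep : |u (z + v) - u (z + w)| ≤ G := by
      rcases hvw with rfl | hvw
      · rw [← add_assoc]
        refine h _ i ((norm_add_le _ _).trans ?_)
        have := norm_le_l1 w
        rw [hw] at this
        linarith
      · have hw' : z + w = z + v + Pi.single i 1 := by rw [hvw]; abel
        rw [hw', abs_sub_comm]
        refine h _ i ((norm_add_le _ _).trans ?_)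
        have := norm_le_l1 v
        rw [hv] at this
        push_cast at this
        linarith
    have := abs_sub_le (u (z + v)) (u (z + w)) (u z)
    linarith

/-- The one-step Harnack inequality for nonnegative harmonic functions. -/
lemma neighbour_le {v : (ι → ℤ) → ℝ} (hv : ∀ z, lap v z = 0) {x : ι → ℤ}
    (h : ∀ y, ‖y - x‖ ≤ 1 → 0 ≤ v y) (i : ι) :
    v (x + Pi.single i 1) ≤ 2 * Fintype.card ι * v x ∧
      v (x - Pi.single i 1) ≤ 2 * Fintype.card ι * v x := by
  have hadd : ∀ j, 0 ≤ v (x + Pi.single j 1) := fun j => h _ (by simp [Pi.norm_single])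
  have hsub : ∀ j, 0 ≤ v (x - Pi.single j 1) := fun j => h _ (by simp [Pi.norm_single])
  have h1 := hv x
  simp only [lap, Finset.sum_sub_distrib, Finset.sum_const, Finset.card_univ,
    nsmul_eq_mul] at h1
  have h2 := Finset.single_le_sum (f := fun j => v (x + Pi.single j 1) + v (x - Pi.single j 1))
    (fun j _ => add_nonneg (hadd j) (hsub j)) (Finset.mem_univ i)
  exact ⟨by linarith [hsub i], by linarith [hadd i]⟩

/-- The Harnack inequality along lattice paths. -/
lemma le_pow_l1_mul {v : (ι → ℤ) → ℝ} (hv : ∀ z, lap v z = 0) {T : ℝ}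
    (h : ∀ x, ‖x‖ ≤ T → 0 ≤ v x) (n : ℕ) :
    ∀ w z : ι → ℤ, l1 w = n → ‖z‖ + n + 1 ≤ T →
      v z ≤ (2 * Fintype.card ι) ^ n * v (z + w) := by
  induction n with
  | zero => intro w z hw _; simp [eq_zero_of_l1_eq_zero hw]
  | succ n ih =>
    intro w z hw hT
    push_cast at hT
    obtain ⟨i, w', hw', hww⟩ := exists_step hw
    have h1 := ih w' z hw' (by linarith)
    have hnorm : ‖z + w‖ ≤ ‖z‖ + n + 1 := by
      have h2 := norm_le_l1 w
      rw [hw] at h2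
      push_cast at h2
      linarith [norm_add_le z w]
    have h3 := neighbour_le hv (x := z + w) (fun y hy => h y (by
      have := norm_le_norm_add_norm_sub (z + w) y
      rw [norm_sub_rev] at this
      linarith)) i
    have h4 : v (z + w') ≤ 2 * Fintype.card ι * v (z + w) := by
      rcases hww with rfl | rfl
      · have := h3.2
        rwa [← add_assoc, add_sub_cancel_right, add_assoc] at this
      · have := h3.1
        rwa [← add_sub_assoc, sub_add_cancel, add_sub_assoc] at this
    calc v z ≤ (2 * Fintype.card ι) ^ n * v (z + w') := h1
      _ ≤ (2 * Fintype.card ι) ^ n * (2 * Fintype.card ι * v (z + w)) := by gcongr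
      _ = _ := by ring

end LatticeHarmonic

/-! ### From a one-sided bound to polynomial growth. -/

namespace LatticeHarmonic

variable {ι : Type*} [Fintype ι]

lemma neg_mul_rpow_le_of_norm_le {u : (ι → ℤ) → ℝ} {C d : ℝ} (hC : 0 ≤ C) (hd : 0 ≤ d)
    (h : ∀ z, -(C * (1 + ‖z‖) ^ d) ≤ u z) {L R : ℝ} (hL : 1 ≤ L) (hR : 1 ≤ R) {z : ι → ℤ}
    (hz : ‖z‖ ≤ L * R) : -(C * (2 * L) ^ d * R ^ d) ≤ u z := by
  refine le_trans ?_ (h z)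
  rw [mul_assoc, ← Real.mul_rpow (by linarith) (by linarith)]
  have : 1 + ‖z‖ ≤ 2 * L * R := by nlinarith
  gcongr

lemma norm_le_of_sqLen_le {z : ι → ℤ} {B : ℝ} (hB : 0 ≤ B) (h : sqLen z ≤ B ^ 2) : ‖z‖ ≤ B :=
  (sq_le_sq₀ (norm_nonneg _) hB).1 ((norm_sq_le_sqLen z).trans h)

variable [DecidableEq ι]

/-- A harmonic function with a one-sided polynomial bound has polynomial growth. -/
lemma exists_pow_bound [Nonempty ι] {u : (ι → ℤ) → ℝ} (hu : ∀ z, lap u z = 0) {C d : ℝ}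
    (hC : 0 ≤ C) (hd : 0 ≤ d) (h : ∀ z, -(C * (1 + ‖z‖) ^ d) ≤ u z) :
    ∃ K ≥ 0, ∃ D : ℕ, d ≤ D ∧ ∀ R ≥ 1, ∀ z, ‖z‖ ≤ R → |u z| ≤ K * R ^ D := by
  set N := Fintype.card ι with hN
  have hN1 : (1 : ℝ) ≤ N := by exact_mod_cast Fintype.card_pos (α := ι)
  have hN2 : (1 : ℝ) ≤ (N : ℝ) ^ 2 := one_le_pow₀ hN1
  set L : ℝ := 20 * N ^ 2 with hL
  have hL1 : 1 ≤ L := by rw [hL]; linarith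
  set C' := C * (2 * L) ^ d with hC'
  have hC'0 : 0 ≤ C' := by positivity
  set A : ℝ := (2 * N) ^ (6 * N ^ 2) * 4 ^ (3 * N) with hA
  have hA1 : 1 ≤ A := by
    rw [hA]
    exact one_le_mul_of_one_le_of_one_le (one_le_pow₀ (by linarith)) (one_le_pow₀ (by norm_num))
  refine ⟨A * (|u 0| + C'), by positivity, 6 * N + ⌈d⌉₊, ?_, fun R hR y hy => ?_⟩
  · push_cast
    linarith [Nat.le_ceil d]
  have hR0 : 0 < R := by linarith
  set P := C' * R ^ d with hP
  have hP0 : 0 ≤ P := by positivity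
  have hlow : ∀ x, ‖x‖ ≤ L * R → -P ≤ u x := fun x hx =>
    neg_mul_rpow_le_of_norm_le hC hd h hL1 hR hx
  set v : (ι → ℤ) → ℝ := fun x => u x + P with hv
  have hvlap : ∀ z, lap v z = 0 := fun z => by rw [hv, lap_add_const, hu]
  have hvpos : ∀ x, ‖x‖ ≤ L * R → 0 ≤ v x := fun x hx => by
    have := hlow x hx
    simp only [hv]; linarith
  have hNR : (N : ℝ) ≤ N ^ 2 * R := by nlinarith
  have hRd : R ^ d ≤ R ^ ⌈d⌉₊ := by
    rw [← Real.rpow_natCast]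
    exact Real.rpow_le_rpow_of_exponent_le hR (Nat.le_ceil d)
  have hyLR : ‖y‖ ≤ L * R := hy.trans (by nlinarith)
  have hup : v y ≤ A * R ^ (6 * N) * (|u 0| + P) := by
    rcases le_or_gt (v y) 0 with hneg | hpos
    · exact hneg.trans (by positivity)
    have hball : ∀ x, sqLen (x - y) ≤ 6 * N → v y / (2 * N) ^ (6 * N ^ 2) ≤ v x := fun x hx => by
      have hnorm : ‖x - y‖ ≤ 6 * N := norm_le_of_sqLen_le (by positivity) (by nlinarith)
      have hl : (l1 (x - y) : ℝ) ≤ 6 * N ^ 2 := (l1_le_norm _).trans (by nlinarith)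
      have h1 := le_pow_l1_mul hvlap hvpos _ (x - y) y rfl (by rw [hL]; nlinarith)
      rw [add_sub_cancel, ← hN] at h1
      have hvx : 0 ≤ v x := by
        refine hvpos x ?_
        have := norm_le_norm_add_norm_sub y x
        rw [norm_sub_rev] at this
        rw [hL]; nlinarith
      rw [div_le_iff₀ (by positivity), mul_comm]
      refine h1.trans ?_
      have : l1 (x - y) ≤ 6 * N ^ 2 := by exact_mod_cast hl
      gcongr
      linarith
    -- Harnack is centred at `y` and evaluated at the origin: a large value at `y` forces a large `v
    -- 0`, with loss `(4R²)^(3N)`. This is the source of the exponent `6N`.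
    have hwh := weak_harnack hvlap (a := 6 * N) (Q := 6 * N * R ^ 2)
      (m := v y / (2 * N) ^ (6 * N ^ 2)) (y := y) (x₀ := 0) le_rfl (by nlinarith) (by positivity)
      (fun x hx => ?_) hball ?_
    · have h2 : 6 * (N : ℝ) / (4 * (6 * N * R ^ 2)) = (4 * R ^ 2)⁻¹ := by
        field_simp
      rw [h2, ← hN, inv_pow, ← div_eq_mul_inv, div_div, div_le_iff₀ (by positivity)] at hwh
      refine hwh.trans ?_
      have h3 : (2 * (N : ℝ)) ^ (6 * N ^ 2) * (4 * R ^ 2) ^ (3 * N) = A * R ^ (6 * N) := by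
        rw [hA, mul_pow 4, ← pow_mul R]; ring_nf
      rw [h3, mul_comm]
      have h4 : v 0 ≤ |u 0| + P := by
        simp only [hv]; linarith [le_abs_self (u 0)]
      gcongr
    · have h3 : ‖x - y‖ ≤ 10 * N * R := norm_le_of_sqLen_le (by positivity) (by
        refine hx.trans ?_
        have : (N : ℝ) * R ^ 2 ≤ N ^ 2 * R ^ 2 := by gcongr; nlinarith
        nlinarith)
      refine hvpos x ?_
      have := norm_le_norm_add_norm_sub y x
      rw [norm_sub_rev] at this
      rw [hL]; nlinarith
    · rw [zero_sub]
      refine (sqLen_le_norm_sq _).trans ?_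
      rw [norm_neg, ← hN]
      have : ‖y‖ ^ 2 ≤ R ^ 2 := by gcongr
      nlinarith
  have hPK : |u 0| + P ≤ (|u 0| + C') * R ^ ⌈d⌉₊ := by
    have h1 : (1 : ℝ) ≤ R ^ ⌈d⌉₊ := one_le_pow₀ hR
    have h2 : P ≤ C' * R ^ ⌈d⌉₊ := by rw [hP]; gcongr
    nlinarith [abs_nonneg (u 0)]
  have hfin : A * R ^ (6 * N) * (|u 0| + P) ≤ A * (|u 0| + C') * R ^ (6 * N + ⌈d⌉₊) := by
    calc A * R ^ (6 * N) * (|u 0| + P)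
        ≤ A * R ^ (6 * N) * ((|u 0| + C') * R ^ ⌈d⌉₊) := by gcongr
      _ = _ := by rw [pow_add]; ring
  have hAR : 1 ≤ A * R ^ (6 * N) :=
    one_le_mul_of_one_le_of_one_le hA1 (one_le_pow₀ hR)
  have hPle : P ≤ A * R ^ (6 * N) * (|u 0| + P) := by
    nlinarith [abs_nonneg (u 0)]
  simp only [hv] at hup
  exact abs_le.2 ⟨by linarith [hlow y hyLR], by linarith⟩

end LatticeHarmonic

/-! ### Bootstrapping to the sharp order of growth. -/

namespace LatticeHarmonic

variable {ι : Type*} [Fintype ι] [DecidableEq ι]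

/-- A harmonic function with a one-sided bound of order `d` is of order `d` on balls up to a small
multiple of its supremum on larger balls. -/
lemma exists_le_add_mul_sup [Nonempty ι] {u : (ι → ℤ) → ℝ} (hu : ∀ z, lap u z = 0) {C d : ℝ}
    (hC : 0 ≤ C) (hd : 0 ≤ d) (h : ∀ z, -(C * (1 + ‖z‖) ^ d) ≤ u z) {L : ℝ}
    (hL : 5 * Fintype.card ι ≤ L) {θ : ℝ} (hθ : 0 < θ) (hθ1 : θ ≤ 1) :
    ∃ C₁ ≥ 0, ∀ R ≥ 1, ∀ K ≥ 0, (∀ z, ‖z‖ ≤ L * R → |u z| ≤ K) →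
      ∀ z, ‖z‖ ≤ R → |u z| ≤ C₁ * R ^ d + θ * K := by
  obtain ⟨K₀, hK₀, D, -, hgrow⟩ := exists_pow_bound hu hC hd h
  set N := Fintype.card ι with hN
  have hN1 : (1 : ℝ) ≤ N := by exact_mod_cast Fintype.card_pos (α := ι)
  have hL1 : 1 ≤ L := by linarith
  set C' := C * (2 * L) ^ d with hC'
  have hC'0 : 0 ≤ C' := by positivity
  -- A path of length at most `N ε R` under the gradient bound `4K(N+1)/R` changes `u` by at most `θ
  -- K`.
  set ε : ℝ := θ / (4 * N * (N + 1)) with hε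
  have hε0 : 0 < ε := by positivity
  have hεN : N * ε ≤ 1 := by
    rw [hε, ← mul_div_assoc, div_le_one (by positivity)]
    nlinarith
  have hε1 : ε ≤ 1 := by nlinarith
  set c : ℝ := (ε ^ 2 / (4 * N)) ^ (3 * N) with hc
  have hc0 : 0 < c := by positivity
  set R₀ : ℝ := max 1 (6 * N / ε) with hR₀
  refine ⟨K₀ * R₀ ^ D + C' + (|u 0| + C') / c, by positivity, fun R hR K hK hb z hz => ?_⟩
  have hR0 : 0 < R := by linarith
  have hRd : 1 ≤ R ^ d := Real.one_le_rpow hR hd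
  have hθK : 0 ≤ θ * K := by positivity
  have e1 : 0 ≤ K₀ * R₀ ^ D * R ^ d := by positivity
  have e2 : 0 ≤ C' * R ^ d := by positivity
  have e3 : 0 ≤ (|u 0| + C') / c * R ^ d := by positivity
  rcases lt_or_ge ((ε * R) ^ 2) (6 * N) with hsmall | hbig
  · have hεR : ε * R ≤ 6 * N := by nlinarith [sq_nonneg (ε * R - 1)]
    have hRR : R ≤ R₀ := le_max_of_le_right (by rw [le_div_iff₀ hε0]; linarith)
    have h1 := hgrow R₀ (le_max_left _ _) z (hz.trans hRR)
    have h2 : K₀ * R₀ ^ D ≤ K₀ * R₀ ^ D * R ^ d := le_mul_of_one_le_right (by positivity) hRd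
    rw [add_mul, add_mul]
    linarith
  set P := C' * R ^ d with hP
  have hlow : ∀ x, ‖x‖ ≤ L * R → -P ≤ u x := fun x hx =>
    neg_mul_rpow_le_of_norm_le hC hd h hL1 hR hx
  have hRN : R ≤ N * R := le_mul_of_one_le_left hR0.le hN1
  have hεR : N * ε * R ≤ R := mul_le_of_le_one_left hR0.le hεN
  have h5NR : 5 * N * R ≤ L * R := by gcongr
  have hup : u z ≤ θ * K + (|u 0| + P) / c := by
    set m := u z + P - θ * K with hm
    rcases le_or_gt m 0 with hm0 | hm0
    · have : 0 ≤ (|u 0| + P) / c := by positivity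
      linarith
    have hgrad : ∀ w i, ‖w‖ ≤ 2 * R →
        |u (w + Pi.single i 1) - u w| ≤ 4 * K * (N + 1) / R := fun w i hw =>
      abs_sub_le_of_harmonic hu hR hK (fun x hx => hb x (by
        have := norm_le_norm_add_norm_sub w x
        rw [norm_sub_rev] at this
        linarith)) i
    have hball : ∀ x, sqLen (x - z) ≤ (ε * R) ^ 2 → m ≤ u x + P := fun x hx => by
      have hn : ‖x - z‖ ≤ ε * R := norm_le_of_sqLen_le (by positivity) hx
      have hl : (l1 (x - z) : ℝ) ≤ N * ε * R := (l1_le_norm _).trans (by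
        rw [mul_assoc]; gcongr)
      have h1 := abs_sub_le_l1_mul hgrad _ (x - z) z rfl (by linarith)
      rw [add_sub_cancel] at h1
      have h2 : (l1 (x - z) : ℝ) * (4 * K * (N + 1) / R) ≤ N * ε * R * (4 * K * (N + 1) / R) := by
        gcongr
      have h3 : N * ε * R * (4 * K * (N + 1) / R) = θ * K := by
        rw [hε]; field_simp
      have := (abs_le.1 h1).1
      linarith
    have hnear : ∀ x : ι → ℤ, sqLen (x - z) ≤ 16 * (N * R ^ 2) → 0 ≤ u x + P := fun x hx => by
      have hn : ‖x - z‖ ≤ 4 * N * R := norm_le_of_sqLen_le (by positivity) (by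
        refine hx.trans ?_
        have h1 : (N : ℝ) * R ^ 2 ≤ N ^ 2 * R ^ 2 := by gcongr; exact le_self_pow₀ hN1 two_ne_zero
        have h2 : (4 * N * R) ^ 2 = 16 * (N ^ 2 * R ^ 2) := by ring
        linarith)
      have := norm_le_norm_add_norm_sub z x
      rw [norm_sub_rev] at this
      have := hlow x (by linarith)
      linarith
    -- Both radii are now proportional to `R`, so the Harnack constant `c` does not depend on `R`.
    have hwh := weak_harnack (v := fun x => u x + P) (fun x => by rw [lap_add_const, hu])
      (a := (ε * R) ^ 2) (Q := N * R ^ 2) (x₀ := 0) hbig (by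
        rw [mul_pow]
        have : ε ^ 2 ≤ N := (pow_le_one₀ hε0.le hε1).trans hN1
        gcongr) hm0 hnear hball (by
        rw [zero_sub]
        refine (sqLen_le_norm_sq _).trans ?_
        rw [norm_neg]
        gcongr)
    have h2 : (ε * R) ^ 2 / (4 * (N * R ^ 2)) = ε ^ 2 / (4 * N) := by field_simp
    rw [h2, ← hN, ← hc, ← le_div_iff₀ hc0] at hwh
    have h3 : (u 0 + P) / c ≤ (|u 0| + P) / c := by
      have := le_abs_self (u 0)
      gcongr
    have : 0 ≤ P := e2
    linarith
  have hmul : (|u 0| + P) / c ≤ (|u 0| + C') / c * R ^ d := by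
    rw [div_mul_eq_mul_div]
    have : |u 0| ≤ |u 0| * R ^ d := le_mul_of_one_le_right (abs_nonneg _) hRd
    gcongr
    rw [add_mul]
    linarith
  have hzL : ‖z‖ ≤ L * R := hz.trans (by linarith)
  rw [add_mul, add_mul]
  exact abs_le.2 ⟨by linarith [hlow z hzL], by linarith⟩

/-- On the lattice, a one-sided bound of order `d` for a harmonic function implies the two-sided
bound of the same order. -/
theorem exists_abs_le_of_neg_le {u : (ι → ℤ) → ℝ} (hu : ∀ z, lap u z = 0) {C d : ℝ}
    (hC : 0 ≤ C) (hd : 0 ≤ d) (h : ∀ z, -(C * (1 + ‖z‖) ^ d) ≤ u z) :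
    ∃ C' ≥ 0, ∀ z, |u z| ≤ C' * (1 + ‖z‖) ^ d := by
  cases isEmpty_or_nonempty ι
  · refine ⟨|u 0|, abs_nonneg _, fun z => ?_⟩
    rw [Subsingleton.elim z 0]
    simp
  obtain ⟨K, hK, D, hdD, hgrow⟩ := exists_pow_bound hu hC hd h
  have hN1 : (1 : ℝ) ≤ Fintype.card ι := by exact_mod_cast Fintype.card_pos (α := ι)
  set L : ℝ := 5 * Fintype.card ι with hL
  have hL1 : 1 ≤ L := by linarith
  have hLD : 1 ≤ L ^ D := one_le_pow₀ hL1
  have hθ : 1 / (2 * L ^ D) ≤ 1 := by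
    rw [div_le_one (by positivity)]; linarith
  obtain ⟨C₁, hC₁, hboot⟩ := exists_le_add_mul_sup hu hC hd h (le_refl L)
    (θ := 1 / (2 * L ^ D)) (by positivity) hθ
  -- With `θ = 1 / (2 L^D)`, enlarging the ball by `L` still halves the `R^D` term, and since `d ≤
  -- D` the `R^d` term reproduces itself with constant `2 * C₁`.
  have hiter : ∀ n : ℕ, ∀ R ≥ 1, ∀ z, ‖z‖ ≤ R →
      |u z| ≤ 2 * C₁ * R ^ d + (1 / 2) ^ n * (K * R ^ D) := by
    intro n
    induction n with
    | zero =>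
      intro R hR z hz
      have : 0 ≤ 2 * C₁ * R ^ d := by positivity
      have := hgrow R hR z hz
      simp only [pow_zero, one_mul]
      linarith
    | succ n ih =>
      intro R hR z hz
      have h1 := hboot R hR _ (by positivity) (ih (L * R) (by nlinarith)) z hz
      refine h1.trans ?_
      have hLd : L ^ d ≤ L ^ D := by
        rw [← Real.rpow_natCast]
        exact Real.rpow_le_rpow_of_exponent_le hL1 hdD
      rw [Real.mul_rpow (by linarith) (by linarith), mul_pow L R]
      have h2 : 1 / (2 * L ^ D) * (2 * C₁ * (L ^ d * R ^ d)) ≤ C₁ * R ^ d := by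
        rw [div_mul_eq_mul_div, one_mul, div_le_iff₀ (by positivity)]
        have : C₁ * R ^ d * L ^ d ≤ C₁ * R ^ d * L ^ D := by gcongr
        linarith
      have h3 : 1 / (2 * L ^ D) * ((1 / 2) ^ n * (K * (L ^ D * R ^ D)))
          = (1 / 2) ^ (n + 1) * (K * R ^ D) := by
        field_simp
        ring
      rw [mul_add, h3]
      linarith
  refine ⟨2 * C₁, by positivity, fun z => ?_⟩
  have hlim : Filter.Tendsto
      (fun n : ℕ => 2 * C₁ * (1 + ‖z‖) ^ d + (1 / 2 : ℝ) ^ n * (K * (1 + ‖z‖) ^ D)) Filter.atTop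
      (nhds (2 * C₁ * (1 + ‖z‖) ^ d + 0 * (K * (1 + ‖z‖) ^ D))) :=
    tendsto_const_nhds.add ((tendsto_pow_atTop_nhds_zero_of_lt_one (by norm_num)
      (by norm_num)).mul_const _)
  rw [zero_mul, add_zero] at hlim
  exact ge_of_tendsto' hlim fun n =>
    hiter n _ (by linarith [norm_nonneg z]) z (by linarith)

/-! ### Differences of harmonic functions. -/

lemma lap_fwdDiff (u : (ι → ℤ) → ℝ) (v z : ι → ℤ) :
    lap (fwdDiff v u) z = lap u (z + v) - lap u z := by
  rw [← lap_translate, ← lap_sub]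
  rfl

/-- Differences of harmonic functions grow one order slower. -/
lemma exists_fwdDiff_bound {u : (ι → ℤ) → ℝ} (hu : ∀ z, lap u z = 0) {K e : ℝ} (hK : 0 ≤ K)
    (h : ∀ R ≥ 1, ∀ z, ‖z‖ ≤ R → |u z| ≤ K * R ^ e) (v : ι → ℤ) :
    ∃ K' ≥ 0, ∀ R ≥ 1, ∀ z, ‖z‖ ≤ R → |fwdDiff v u z| ≤ K' * R ^ (e - 1) := by
  set n := l1 v with hn
  refine ⟨n * (4 * (K * (3 + n) ^ e) * (Fintype.card ι + 1)), by positivity,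
    fun R hR z hz => ?_⟩
  have hR0 : 0 < R := by linarith
  have hn0 : (0 : ℝ) ≤ n := by positivity
  have hgrad : ∀ w i, ‖w‖ ≤ R + n → |u (w + Pi.single i 1) - u w|
      ≤ 4 * (K * ((3 + n) * R) ^ e) * (Fintype.card ι + 1) / R := fun w i hw =>
    abs_sub_le_of_harmonic hu hR (by positivity) (fun x hx => h _ (by nlinarith) x (by
      have := norm_le_norm_add_norm_sub w x
      rw [norm_sub_rev] at this
      nlinarith)) i
  refine (abs_sub_le_l1_mul hgrad n v z hn.symm (by linarith)).trans (le_of_eq ?_)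
  rw [Real.mul_rpow (by positivity) hR0.le, Real.rpow_sub_one hR0.ne']
  ring

/-- A harmonic function of polynomial growth is annihilated by high powers of differences. -/
theorem exists_fwdDiff_iterate_eq_zero {u : (ι → ℤ) → ℝ} (hu : ∀ z, lap u z = 0) {C d : ℝ}
    (hC : 0 ≤ C) (hd : 0 ≤ d) (h : ∀ z, |u z| ≤ C * (1 + ‖z‖) ^ d) (v : ι → ℤ) :
    ∃ k : ℕ, ∀ z, (fwdDiff v)^[k] u z = 0 := by
  -- The bound is stated for every ball containing `z`, so that once the exponent `d - k` is
  -- negative, letting `R → ∞` forces the value to be zero.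
  have hiter : ∀ k : ℕ, (∀ z, lap ((fwdDiff v)^[k] u) z = 0) ∧ ∃ K ≥ 0, ∀ R ≥ 1, ∀ z, ‖z‖ ≤ R →
      |(fwdDiff v)^[k] u z| ≤ K * R ^ (d - k) := by
    intro k
    induction k with
    | zero =>
      refine ⟨hu, C * 2 ^ d, by positivity, fun R hR z hz => (h z).trans ?_⟩
      rw [Nat.cast_zero, sub_zero, mul_assoc, ← Real.mul_rpow (by norm_num) (by linarith)]
      have : 1 + ‖z‖ ≤ 2 * R := by linarith
      gcongr
    | succ k ih =>
      obtain ⟨hlap, K, hK, hb⟩ := ih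
      simp only [Function.iterate_succ_apply']
      refine ⟨fun z => by rw [lap_fwdDiff, hlap, hlap, sub_zero], ?_⟩
      obtain ⟨K', hK', hb'⟩ := exists_fwdDiff_bound hlap hK hb v
      refine ⟨K', hK', ?_⟩
      rwa [Nat.cast_succ, ← sub_sub]
  obtain ⟨k, hk⟩ := exists_nat_gt d
  obtain ⟨-, K, hK, hb⟩ := hiter k
  refine ⟨k, fun z => abs_nonpos_iff.1 ?_⟩
  have hlim : Filter.Tendsto (fun R : ℝ => K * R ^ (-(k - d))) Filter.atTop (nhds (K * 0)) :=
    (tendsto_rpow_neg_atTop (by linarith)).const_mul K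
  rw [mul_zero] at hlim
  refine ge_of_tendsto hlim ?_
  filter_upwards [Filter.eventually_ge_atTop (max 1 ‖z‖)] with R hR
  rw [neg_sub]
  exact hb R (le_of_max_le_left hR) z (le_of_max_le_right hR)

end LatticeHarmonic

/-! ### Lifting Cayley graphs to the lattice of generators. -/

namespace AbelianCayley

open LatticeHarmonic

lemma exists_family {G : Type*} (S : Multiset G) :
    ∃ (n : ℕ) (s : Fin n → G), S = Finset.univ.val.map s := by
  obtain ⟨l, rfl⟩ := Quot.exists_rep S
  exact ⟨l.length, l.get, by rw [Fin.univ_val_map, List.ofFn_get]; rfl⟩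

section family

variable {G : Type*} [AddCommGroup G] {ι : Type*} [Fintype ι]

lemma laplacian_map (s : ι → G) (u : G → ℝ) (x : G) :
    laplacian (Finset.univ.val.map s) u x = ∑ i, (u (x + s i) - u x) := by
  rw [laplacian, Multiset.map_map]; rfl

/-- Symmetry of `S` with multiplicities makes the backward half of the lattice Laplacian equal to
the forward half. -/
lemma sum_sub_eq_laplacian {s : ι → G} (hs : IsSymmGen (Finset.univ.val.map s)) (u : G → ℝ)
    (x : G) : ∑ i, (u (x - s i) - u x) = laplacian (Finset.univ.val.map s) u x := by
  rw [laplacian, ← hs.symm, Multiset.map_map, Multiset.map_map]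
  simp only [Function.comp_def, ← sub_eq_add_neg]
  rfl

lemma linearCombination_surjective {s : ι → G} (hs : IsSymmGen (Finset.univ.val.map s)) :
    Function.Surjective (Fintype.linearCombination ℤ s) := by
  classical
  have h : AddSubgroup.closure {x : G | x ∈ Finset.univ.val.map s}
      ≤ (Fintype.linearCombination ℤ s).toAddMonoidHom.range := by
    rw [AddSubgroup.closure_le]
    intro x hx
    obtain ⟨i, -, rfl⟩ := Multiset.mem_map.1 hx
    exact ⟨Pi.single i 1, by simp⟩
  rw [hs.gen] at h
  exact fun x => h (AddSubgroup.mem_top x)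

lemma fwdDiff_lift (s : ι → G) (u : G → ℝ) (q : G) (v : ι → ℤ) (k : ℕ) :
    (fwdDiff v)^[k] (fun z => u (q + Fintype.linearCombination ℤ s z))
      = fun z => (fwdDiff (Fintype.linearCombination ℤ s v))^[k] u
        (q + Fintype.linearCombination ℤ s z) := by
  induction k with
  | zero => rfl
  | succ k ih =>
    funext z
    simp only [Function.iterate_succ_apply', ih, fwdDiff, map_add, add_assoc]

variable [DecidableEq ι]

/-- The lift of a harmonic function on a Cayley graph to the lattice of its generators. -/
lemma lap_lift {s : ι → G} (hs : IsSymmGen (Finset.univ.val.map s)) {u : G → ℝ}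
    (hu : IsHarmonic (Finset.univ.val.map s) u) (q : G) (z : ι → ℤ) :
    lap (fun z => u (q + Fintype.linearCombination ℤ s z)) z = 0 := by
  have h1 := laplacian_map s u (q + Fintype.linearCombination ℤ s z)
  have h2 := sum_sub_eq_laplacian hs u (q + Fintype.linearCombination ℤ s z)
  rw [hu] at h1 h2
  rw [lap]
  simp only [map_add, map_sub, Fintype.linearCombination_apply_single, one_smul]
  rw [← add_zero (0 : ℝ)]
  nth_rewrite 1 [h1]
  rw [← h2, ← Finset.sum_add_distrib]
  refine Finset.sum_congr rfl fun i _ => ?_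
  rw [← add_assoc, ← add_sub_assoc q]
  ring

lemma exists_path {s : ι → G} (hs : IsSymmGen (Finset.univ.val.map s)) (x : G) (n : ℕ) :
    ∀ z : ι → ℤ, l1 z = n → ∃ c : ℕ → G, c 0 = x ∧ c n = x + Fintype.linearCombination ℤ s z ∧
      ∀ i < n, Adj (Finset.univ.val.map s) (c i) (c (i + 1)) := by
  induction n with
  | zero => exact fun z hz => ⟨fun _ => x, rfl, by simp [eq_zero_of_l1_eq_zero hz], by simp⟩
  | succ n ih =>
    intro z hz
    obtain ⟨i, w, hw, hzw⟩ := exists_step hz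
    obtain ⟨c, hc0, hcn, hc⟩ := ih w hw
    refine ⟨fun j => if j ≤ n then c j else x + Fintype.linearCombination ℤ s z, by simpa using hc0,
      by simp, fun j hj => ?_⟩
    rcases Nat.lt_succ_iff_lt_or_eq.1 hj with hj | rfl
    · simpa [hj.le, Nat.succ_le_of_lt hj] using hc j hj
    · have hi : s i ∈ Finset.univ.val.map s := Multiset.mem_map_of_mem s (Finset.mem_univ i)
      simp only [le_refl, if_true, Nat.not_succ_le_self, if_false, Adj, hcn]
      rcases hzw with rfl | rfl
      · simp
      · rw [← hs.symm]
        refine Multiset.mem_map.2 ⟨s i, hi, ?_⟩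
        rw [map_sub, Fintype.linearCombination_apply_single, one_smul]
        abel

lemma wordDist_add_le {s : ι → G} (hs : IsSymmGen (Finset.univ.val.map s)) (x : G) (z : ι → ℤ) :
    wordDist (Finset.univ.val.map s) x (x + Fintype.linearCombination ℤ s z) ≤ l1 z :=
  Nat.sInf_le (exists_path hs x _ z rfl)

/-- A geodesic from `x` to `y` spells out a lattice path, one unit vector per edge. -/
lemma exists_norm_le_wordDist {s : ι → G} (hs : IsSymmGen (Finset.univ.val.map s)) (x y : G) :
    ∃ z : ι → ℤ, y = x + Fintype.linearCombination ℤ s z ∧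
      ‖z‖ ≤ wordDist (Finset.univ.val.map s) x y := by
  obtain ⟨z₀, hz₀⟩ := linearCombination_surjective hs (y - x)
  obtain ⟨c, hc0, hck, hc⟩ : wordDist (Finset.univ.val.map s) x y ∈ _ := Nat.sInf_mem (by
    obtain ⟨c, h0, h1, h2⟩ := exists_path hs x _ z₀ rfl
    exact ⟨l1 z₀, c, h0, by rw [h1, hz₀, add_sub_cancel], h2⟩)
  set k := wordDist (Finset.univ.val.map s) x y
  have h : ∀ j ≤ k, ∃ z : ι → ℤ, c j = x + Fintype.linearCombination ℤ s z ∧ ‖z‖ ≤ j := by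
    intro j
    induction j with
    | zero => exact fun _ => ⟨0, by simp [hc0]⟩
    | succ j ih =>
      intro hj
      obtain ⟨z, hz, hn⟩ := ih (by omega)
      obtain ⟨i, -, hi⟩ := Multiset.mem_map.1 (hc j (by omega))
      refine ⟨z + Pi.single i 1, ?_, (norm_add_le _ _).trans ?_⟩
      · rw [map_add, ← add_assoc, ← hz, Fintype.linearCombination_apply_single, one_smul, hi,
          add_sub_cancel]
      · rw [norm_single_one]; push_cast; linarith
  obtain ⟨z, hz, hn⟩ := h k le_rfl
  exact ⟨z, hck ▸ hz, hn⟩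

/-- Bounds of order `d` in the word metric, read off on the lattice of the generators. -/
lemma wordDist_bound_iff {s : ι → G} (hs : IsSymmGen (Finset.univ.val.map s)) (p q : G) {d : ℝ}
    (hd : 0 ≤ d) (f : G → ℝ) :
    (∃ C : ℝ, ∀ x, f x ≤ C * ((wordDist (Finset.univ.val.map s) p x : ℝ) + 1) ^ d) ↔
      ∃ C ≥ 0, ∀ z : ι → ℤ, f (q + Fintype.linearCombination ℤ s z) ≤ C * (1 + ‖z‖) ^ d := by
  obtain ⟨z₀, hz₀⟩ := linearCombination_surjective hs (q - p)
  constructor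
  · rintro ⟨C, hC⟩
    set A : ℝ := Fintype.card ι * ‖z₀‖ + Fintype.card ι + 1 with hA
    refine ⟨max C 0 * A ^ d, by positivity, fun z => (hC _).trans ?_⟩
    rw [mul_assoc, ← Real.mul_rpow (by positivity) (by positivity)]
    have h1 := wordDist_add_le hs p (z₀ + z)
    rw [map_add, hz₀, ← add_assoc, add_sub_cancel] at h1
    have h2 : (wordDist (Finset.univ.val.map s) p (q + Fintype.linearCombination ℤ s z) : ℝ)
        ≤ Fintype.card ι * (‖z₀‖ + ‖z‖) := by
      refine (Nat.cast_le.2 h1).trans ((l1_le_norm _).trans ?_)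
      have := norm_add_le z₀ z
      gcongr
    have h3 : (wordDist (Finset.univ.val.map s) p (q + Fintype.linearCombination ℤ s z) : ℝ) + 1
        ≤ A * (1 + ‖z‖) := by
      have : 0 ≤ Fintype.card ι * ‖z₀‖ * ‖z‖ := by positivity
      have := norm_nonneg z
      have : (0 : ℝ) ≤ Fintype.card ι := by positivity
      rw [hA]; nlinarith
    have h4 := le_max_left C 0
    gcongr
  · rintro ⟨C, hC0, hC⟩
    refine ⟨C * (1 + ‖z₀‖) ^ d, fun x => ?_⟩
    obtain ⟨z, hz, hn⟩ := exists_norm_le_wordDist hs p x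
    have h1 := hC (z - z₀)
    rw [map_sub, hz₀] at h1
    have h2 : q + (Fintype.linearCombination ℤ s z - (q - p)) = x := by rw [hz]; abel
    rw [h2] at h1
    refine h1.trans ?_
    rw [mul_assoc, ← Real.mul_rpow (by positivity) (by positivity)]
    have h3 : 1 + ‖z - z₀‖
        ≤ (1 + ‖z₀‖) * ((wordDist (Finset.univ.val.map s) p x : ℝ) + 1) := by
      have := norm_sub_le z z₀
      nlinarith [norm_nonneg z₀, norm_nonneg z]
    gcongr

lemma mem_H_iff {s : ι → G} (hs : IsSymmGen (Finset.univ.val.map s)) (p q : G) {d : ℝ}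
    (hd : 0 ≤ d) (u : G → ℝ) :
    u ∈ H (Finset.univ.val.map s) p d ↔ IsHarmonic (Finset.univ.val.map s) u ∧
      ∃ C ≥ 0, ∀ z : ι → ℤ, |u (q + Fintype.linearCombination ℤ s z)| ≤ C * (1 + ‖z‖) ^ d :=
  and_congr_right fun _ => wordDist_bound_iff hs p q hd fun x => |u x|

end family

/-! ### Vanishing differences along torsion elements. -/

section torsion

variable {G : Type*} [AddCommGroup G]

/-- Along the orbit of `t` the function is affine in the number of steps, and it returns to its
initial value after `n` steps, so the slope is zero. -/
lemma fwdDiff_eq_zero_of_fwdDiff_fwdDiff {f : G → ℝ} {t : G} {n : ℕ} (hn : n ≠ 0)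
    (ht : n • t = 0) (h : ∀ x, fwdDiff t (fwdDiff t f) x = 0) (x : G) : fwdDiff t f x = 0 := by
  have hconst : ∀ j : ℕ, fwdDiff t f (x + j • t) = fwdDiff t f x := by
    intro j
    induction j with
    | zero => simp
    | succ j ih =>
      have := h (x + j • t)
      rw [fwdDiff, ih, sub_eq_zero] at this
      rw [succ_nsmul, ← add_assoc, this]
  have hlin : ∀ j : ℕ, f (x + j • t) = f x + j * fwdDiff t f x := by
    intro j
    induction j with
    | zero => simp
    | succ j ih =>
      have := hconst j
      rw [fwdDiff, ih] at this
      rw [succ_nsmul, ← add_assoc]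
      push_cast
      linarith
  have := hlin n
  rw [ht, add_zero] at this
  have h0 : (n : ℝ) * fwdDiff t f x = 0 := by linarith
  exact (mul_eq_zero.1 h0).resolve_left (by exact_mod_cast hn)

/-- A function annihilated by a power of the difference along a torsion element is invariant. -/
lemma apply_add_eq_of_fwdDiff_iterate {f : G → ℝ} {t : G} {n : ℕ} (hn : n ≠ 0) (ht : n • t = 0)
    {k : ℕ} (h : ∀ x, (fwdDiff t)^[k] f x = 0) (x : G) : f (x + t) = f x := by
  have hone : ∀ k : ℕ, (∀ x, (fwdDiff t)^[k + 1] f x = 0) → ∀ x, fwdDiff t f x = 0 := by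
    intro k
    induction k with
    | zero => exact id
    | succ k ih =>
      intro h
      refine ih fun x => ?_
      rw [Function.iterate_succ_apply']
      refine fwdDiff_eq_zero_of_fwdDiff_fwdDiff hn ht (fun x => ?_) x
      rw [← Function.iterate_succ_apply' (fwdDiff t), ← Function.iterate_succ_apply' (fwdDiff t)]
      exact h x
  refine sub_eq_zero.1 (hone k (fun x => ?_) x)
  rw [Function.iterate_succ_apply']
  simp [fwdDiff, h]

end torsion

/-! ### Growth classes on Cayley graphs and surjective images. -/

variable {G : Type*} [AddCommGroup G]

/-- The one-sided growth condition of order `d` spans the space of two-sided growth `d`. -/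
theorem HM_eq_H {S : Multiset G} (hS : IsSymmGen S) (p : G) {d : ℝ} (hd : 0 ≤ d) :
    HM S p d = H S p d := by
  obtain ⟨n, s, rfl⟩ := exists_family S
  refine le_antisymm (Submodule.span_le.2 ?_) fun u hu => Submodule.subset_span ?_
  · rintro u ⟨hu, C, hC⟩
    refine (mem_H_iff hS p p hd u).2 ⟨hu, ?_⟩
    obtain ⟨C', hC'0, hC'⟩ := (wordDist_bound_iff hS p p hd fun x => -u x).1
      ⟨C, fun x => by linarith [hC x]⟩
    exact exists_abs_le_of_neg_le (lap_lift hS hu p) hC'0 hd fun z => by linarith [hC' z]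
  · obtain ⟨hu, C, hC⟩ := hu
    exact ⟨hu, C, fun x => by linarith [hC x, neg_abs_le (u x)]⟩

/-- Harmonic functions of polynomial growth are invariant under torsion elements. -/
theorem apply_add_eq_of_mem_H {S : Multiset G} (hS : IsSymmGen S) {p : G} {d : ℝ} (hd : 0 ≤ d)
    {u : G → ℝ} (hu : u ∈ H S p d) {n : ℕ} (hn : n ≠ 0) {t : G} (ht : n • t = 0) (x : G) :
    u (x + t) = u x := by
  obtain ⟨m, s, rfl⟩ := exists_family S
  obtain ⟨hu, C, hC0, hC⟩ := (mem_H_iff hS p p hd u).1 hu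
  obtain ⟨v, rfl⟩ := linearCombination_surjective hS t
  obtain ⟨k, hk⟩ := exists_fwdDiff_iterate_eq_zero (lap_lift hS hu p) hC0 hd hC v
  refine apply_add_eq_of_fwdDiff_iterate hn ht (k := k) (fun y => ?_) x
  obtain ⟨z, hz⟩ := linearCombination_surjective hS (y - p)
  have h := hk z
  rw [fwdDiff_lift] at h
  simpa only [hz, add_sub_cancel] using h

lemma IsSymmGen.map {S : Multiset G} (hS : IsSymmGen S) {G' : Type*} [AddCommGroup G']
    (f : G →+ G') (hf : Function.Surjective f) : IsSymmGen (S.map f) where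
  symm := by
    conv_rhs => rw [← hS.symm]
    simp only [Multiset.map_map, Function.comp_def, map_neg]
  gen := by
    have h : {x : G' | x ∈ S.map f} = f '' {x | x ∈ S} := by
      ext; simp
    rw [h, ← AddMonoidHom.map_closure, hS.gen, ← AddMonoidHom.range_eq_map,
      AddMonoidHom.range_eq_top.2 hf]

lemma laplacian_comp {G' : Type*} [AddCommGroup G'] (S : Multiset G) (f : G →+ G') (g : G' → ℝ)
    (x : G) : laplacian S (fun x => g (f x)) x = laplacian (S.map f) g (f x) := by
  simp only [laplacian, Multiset.map_map, Function.comp_def, map_add]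

end AbelianCayley

theorem theorem1p3 {G : Type*} [AddCommGroup G]
    -- the decomposition `G = G₁ ⊕ G₂ ≅ ℤ^m ⊕ ⨁ ℤ/(r_i ^ a_i)`, `r_i` prime
    (G₁ G₂ : Submodule ℤ G) (h : IsCompl G₁ G₂)
    (m : ℕ) (e₁ : G₁ ≃+ (Fin m → ℤ))
    (l : ℕ) (r a : Fin l → ℕ) (hr : ∀ i, (r i).Prime)
    (e₂ : G₂ ≃+ ((i : Fin l) → ZMod (r i ^ a i)))
    -- the Cayley graph and the base points of `G` and `G₁`
    (S : Multiset G) (hS : AbelianCayley.IsSymmGen S) (p : G) (p₁ : G₁)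
    (d : ℝ) (hd : 0 ≤ d) :
    AbelianCayley.HM S p d = AbelianCayley.H S p d ∧
    -- functions on `G₁` are regarded as functions on `G` through `π_{G₁}`
    AbelianCayley.H S p d =
      (AbelianCayley.H (S.map (AbelianCayley.proj h)) p₁ d).map
        (LinearMap.funLeft ℝ ℝ (AbelianCayley.proj h)) := by
  refine ⟨AbelianCayley.HM_eq_H hS p hd, ?_⟩
  set π := AbelianCayley.proj h with hπ
  have hπid : ∀ x : G₁, π x = x := fun x => Submodule.projectionOnto_apply_left h x
  have hπsurj : Function.Surjective π := fun x => ⟨x, hπid x⟩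
  have hker : ∀ x, x - π x ∈ G₂ := fun x => by
    rw [← Submodule.projectionOnto_apply_eq_zero_iff h, map_sub]
    exact sub_eq_zero.2 (hπid (π x)).symm
  have hS₁ : AbelianCayley.IsSymmGen (S.map π) := hS.map π.toAddMonoidHom hπsurj
  -- torsion of the second summand
  have htors : ∀ t ∈ G₂, (∏ i, r i ^ a i) • t = 0 := fun t ht => by
    have h1 : (∏ i, r i ^ a i) • (⟨t, ht⟩ : G₂) = 0 := by
      apply e₂.injective
      rw [map_nsmul, map_zero]
      ext i
      have h2 : ((∏ i, r i ^ a i : ℕ) : ZMod (r i ^ a i)) = 0 :=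
        (ZMod.natCast_eq_zero_iff _ _).2 (Finset.dvd_prod_of_mem _ (Finset.mem_univ i))
      rw [Pi.smul_apply, nsmul_eq_mul, h2, zero_mul, Pi.zero_apply]
    exact congrArg Subtype.val h1
  have hprod : ∏ i, r i ^ a i ≠ 0 :=
    Finset.prod_ne_zero_iff.2 fun i _ => pow_ne_zero _ (hr i).ne_zero
  -- With base points `p` and `π p`, the lifts of `g ∘ π` by `s` and of `g` by `π ∘ s` are the same
  -- function on `ℤ^n`, so no comparison of the two word metrics is needed.
  have hmem : ∀ g : G₁ → ℝ, (fun x => g (π x)) ∈ AbelianCayley.H S p d ↔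
      g ∈ AbelianCayley.H (S.map π) p₁ d := by
    intro g
    obtain ⟨n, s, rfl⟩ := AbelianCayley.exists_family S
    have hcomb : ∀ z : Fin n → ℤ, Fintype.linearCombination ℤ (fun i => π (s i)) z
        = π (Fintype.linearCombination ℤ s z) := fun z => by
      simp [Fintype.linearCombination_apply]
    rw [AbelianCayley.mem_H_iff hS p p hd]
    rw [Multiset.map_map] at hS₁ ⊢
    rw [AbelianCayley.mem_H_iff hS₁ p₁ (π p) hd]
    refine and_congr ?_ ?_
    · rw [← Multiset.map_map]
      refine ⟨fun hg x => ?_, fun hg x => ?_⟩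
      · obtain ⟨y, rfl⟩ := hπsurj x
        exact (AbelianCayley.laplacian_comp _ π.toAddMonoidHom g y).symm.trans (hg y)
      · exact (AbelianCayley.laplacian_comp _ π.toAddMonoidHom g x).trans (hg (π x))
    · simp only [Function.comp_def, hcomb, map_add]
  ext u
  rw [Submodule.mem_map]
  constructor
  · intro hu
    have hinv : (fun x => u (π x)) = u := funext fun x => by
      have := AbelianCayley.apply_add_eq_of_mem_H hS hd hu hprod (htors _ (hker x)) (π x)
      rwa [add_sub_cancel, eq_comm] at this
    exact ⟨fun x => u x, (hmem _).1 (hinv.symm ▸ hu), hinv⟩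
  · rintro ⟨g, hg, rfl⟩
    exact (hmem g).2 hg
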